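/- Model. Asynchronous processes communicate by applying atomic operations to shared objects; an algorithm may use any number (possibly infinitely many) of objects of a given type $T$ together with read/write registers, each initialized to a state chosen by the algorithm. The type $\mathrm{stack}$ has as states the finite sequences over a non-empty set $V$, with operations $\mathrm{Push}(v)$ (adds $v\in V$ on top and returns an acknowledgement) and $\mathrm{Pop}$ (removes and returns the top element, or returns $\mathrm{empty}$ if the sequence is empty). In the independent crash model, each process may at any time, individually, crash and recover: its local memory is reset and it executes its code again from the beginning with the same input, while shared objects keep their states. An algorithm in which each process has an input from a set $D$ with at least two elements solves *recoverable consensus* (RC) if every execution satisfies: (agreement) no two outputs are different, including outputs of the same process in different runs; (validity) each output is the input of some process; (recoverable wait-freedom) a process that executes its code from the beginning crashes or outputs a value after finitely many of its own steps. It solves (wait-free) *consensus* if these properties hold in all executions without crash-recovery (where processes may simply halt). Let $\mathrm{rcons}(T)$ (resp. $\mathrm{cons}(T)$) be the maximum number $n$ of processes for which RC with independent crashes (resp. consensus) can be solved using objects of type $T$ and registers, or $\infty$ if there is no maximum. Theorem. Two processes cannot solve recoverable consensus with independent crashes using stacks and registers. Hence $\mathrm{rcons}(\mathrm{stack})=1$,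 whereas $\mathrm{cons}(\mathrm{stack})=2$. (This holds for every non-empty set $V$ of stack elements and every input set $D$ with at least two elements.) -/

import Mathlib

universe u

namespace SharedMemory

/-- A deterministic shared object type, given by its sequential specification: applying an
operation to an object in a given state yields a unique new state and response. -/
structure ObjType where
  State : Type u
  Op : Type u
  Resp : Type u
  apply : State → Op → State × Resp

inductive StackOp (V : Type u) : Type u
  | push (v : V)
  | pop

inductive StackResp (V : Type u) : Type u
  | ack
  | popped (v : V)
  | empty

/-- The stack type with elements from `V`.  The head of the list is the top of the stack;
popping an empty stack leaves it empty and returns `empty`. -/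
def stack (V : Type u) : ObjType.{u} where
  State := List V
  Op := StackOp V
  Resp := StackResp V
  apply
    | s, .push v => (v :: s, .ack)
    | [], .pop => ([], .empty)
    | v :: s, .pop => (s, .popped v)

inductive RegOp (W : Type u) : Type u
  | read
  | write (w : W)

inductive RegResp (W : Type u) : Type u
  | ack
  | value (w : W)

/-- The read/write register type with values from `W`. -/
def register (W : Type u) : ObjType.{u} where
  State := W
  Op := RegOp W
  Resp := RegResp W
  apply
    | s, .read => (s, .value s)
    | _, .write w => (w, .ack)

/-- What a process does next, as prescribed by its code in its current local state: output a
value (which ends its current run), or apply an operation atomically to a shared object and move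
to a new local state that depends on the response. -/
inductive Action (T R : ObjType.{u}) (Obj Reg Loc D : Type u) : Type u
  | output (v : D)
  | onObj (o : Obj) (op : T.Op) (k : T.Resp → Loc)
  | onReg (r : Reg) (op : R.Op) (k : R.Resp → Loc)

/-- An algorithm for `n` processes with inputs and outputs in `D`, using shared objects of type
`T` and registers.  There may be infinitely many shared objects, each with an initial state chosen
by the algorithm.  `init p x` is the state of the local memory (with the program counter) of
process `p` at the beginning of its code, when its input is `x`. -/
structure Algorithm (T : ObjType.{u}) (n : ℕ) (D : Type u) where
  Obj : Type u
  objInit : Obj → T.State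
  Reg : Type u
  RegVal : Type u
  regInit : Reg → RegVal
  Loc : Type u
  init : Fin n → D → Loc
  next : Fin n → Loc → Action T (register RegVal) Obj Reg Loc D

/-- Events of an execution: a process takes the next step of its code, or it crashes. -/
inductive Event (n : ℕ) : Type
  | step (p : Fin n)
  | crash (p : Fin n)

/-- An infinite sequence of events.  (Finite executions are the prefixes.  A process
may cease taking steps at any time.) -/
abbrev Schedule (n : ℕ) : Type := ℕ → Event n

namespace Algorithm

variable {T : ObjType.{u}} {n : ℕ} {D : Type u}

/-- A configuration: local states of all processes (volatile) and states of all shared objects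
(non-volatile). -/
structure Config (A : Algorithm T n D) where
  loc : Fin n → A.Loc
  obj : A.Obj → T.State
  reg : A.Reg → A.RegVal

def initial (A : Algorithm T n D) (inp : Fin n → D) : A.Config where
  loc p := A.init p (inp p)
  obj := A.objInit
  reg := A.regInit

open Classical in
/-- The effect of one event.  A step of a process that has already output a value in its current
run does nothing.  A crash of `p` resets the local state of `p`, so that `p` will execute
its code again from the beginning with the same input; shared objects are unaffected. -/
noncomputable def exec (A : Algorithm T n D) (inp : Fin n → D) (c : A.Config) :
    Event n → A.Config
  | .step p =>
    match A.next p (c.loc p) with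
    | .output _ => c
    | .onObj o op k =>
      { loc := Function.update c.loc p (k (T.apply (c.obj o) op).2)
        obj := Function.update c.obj o (T.apply (c.obj o) op).1
        reg := c.reg }
    | .onReg r op k =>
      { loc := Function.update c.loc p (k ((register A.RegVal).apply (c.reg r) op).2)
        obj := c.obj
        reg := Function.update c.reg r ((register A.RegVal).apply (c.reg r) op).1 }
  | .crash p => { c with loc := Function.update c.loc p (A.init p (inp p)) }

/-- The configuration after the first `t` events of the schedule `σ`. -/
noncomputable def configAt (A : Algorithm T n D) (inp : Fin n → D) (σ : Schedule n) :
    ℕ → A.Config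
  | 0 => A.initial inp
  | t + 1 => A.exec inp (A.configAt inp σ t) (σ t)

/-- In the configuration reached after `t` events, process `p` has output `v` in its current
run. -/
def Outputs (A : Algorithm T n D) (inp : Fin n → D) (σ : Schedule n) (t : ℕ) (p : Fin n)
    (v : D) : Prop :=
  A.next p ((A.configAt inp σ t).loc p) = .output v

/-- No two outputs produced are different, whether by different processes or by the same process
in different runs. -/
def Agreement (A : Algorithm T n D) (inp : Fin n → D) (σ : Schedule n) : Prop :=
  ∀ t t' p p' v v', A.Outputs inp σ t p v → A.Outputs inp σ t' p' v' → v = v'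

/-- Each output is the input of some process. -/
def Validity (A : Algorithm T n D) (inp : Fin n → D) (σ : Schedule n) : Prop :=
  ∀ t p v, A.Outputs inp σ t p v → ∃ q, inp q = v

/-- (Recoverable) wait-freedom: a process that does not crash from some time on and that takes
infinitely many steps outputs a value after that time. -/
def WaitFree (A : Algorithm T n D) (inp : Fin n → D) (σ : Schedule n) : Prop :=
  ∀ p t₀, (∀ t, t₀ ≤ t → σ t ≠ .crash p) → (∀ s, ∃ t, s ≤ t ∧ σ t = .step p) →
    ∃ t v, t₀ ≤ t ∧ A.Outputs inp σ t p v

/-- `A` solves recoverable consensus with independent crashes: the three properties hold in all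
executions, where processes crash and recover individually at arbitrary times. -/
def SolvesRC (A : Algorithm T n D) : Prop :=
  ∀ inp σ, A.Agreement inp σ ∧ A.Validity inp σ ∧ A.WaitFree inp σ

/-- `A` solves standard wait-free consensus: the three properties hold in all executions without
crash-recovery events (a halting failure is a process that takes no more steps). -/
def SolvesConsensus (A : Algorithm T n D) : Prop :=
  ∀ inp σ, (∀ t p, σ t ≠ .crash p) →
    A.Agreement inp σ ∧ A.Validity inp σ ∧ A.WaitFree inp σ

end Algorithm

/-- Recoverable consensus among `n` processes with inputs from `D` is solvable using objects of
type `T` and registers, with independent crashes. -/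
def RCSolvable (T : ObjType.{u}) (D : Type u) (n : ℕ) : Prop :=
  ∃ A : Algorithm T n D, A.SolvesRC

/-- Wait-free consensus among `n` processes with inputs from `D` is solvable using objects of
type `T` and registers. -/
def ConsensusSolvable (T : ObjType.{u}) (D : Type u) (n : ℕ) : Prop :=
  ∃ A : Algorithm T n D, A.SolvesConsensus

/-- The independent RC number: the maximum number of processes that can solve RC using objects of
type `T` and registers, or `⊤` if there is no maximum. -/
noncomputable def rcons (T : ObjType.{u}) (D : Type u) : ℕ∞ :=
  sSup {m : ℕ∞ | ∃ n : ℕ, m = n ∧ RCSolvable T D n}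

/-- The consensus number: the maximum number of processes that can solve consensus using objects
of type `T` and registers, or `⊤` if there is no maximum. -/
noncomputable def cons (T : ObjType.{u}) (D : Type u) : ℕ∞ :=
  sSup {m : ℕ∞ | ∃ n : ℕ, m = n ∧ ConsensusSolvable T D n}

end SharedMemory

/-!
A history is undecided if different outputs are still possible. Wait-freedom forbids an infinite
sequence of undecided histories, so some undecided history is critical: every further event decides
the outcome, and the next steps of two processes `p` and `q` decide differently. If one of these
two operations overwrites the other (as always happens when they access a common register), or if
they access different objects, some process cannot tell which one came first. The remaining case is
two operations on the same stack. Exchanging them changes at most two responses in all, those to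
`p` and `q` and to future operations taken together, so letting processes run solo uses up these
differences while spoiling the local states of at most two processes. A third process therefore
cannot tell the two orders apart. Under recoverable consensus two processes are enough, because one
of them can crash, which makes it forget the difference that it has observed.

With arbitrary crashes a process may crash forever without ever being bound to output, and a
critical history need not exist. Crashes are therefore allowed only after a step of a process of
lower index. This restores the existence of critical histories, and it still lets one of `p` and `q`
crash after both have taken their steps, in either order.

Conversely, two processes agree by popping from a stack with a single element: whoever obtains the
element wins.
-/

namespace SharedMemory

open Filter

namespace ObjType

section Similar

variable {T : ObjType.{u}}

open Classical in
/-- The number of operations that return different responses when the sequence of operations is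
applied to an object in either of two states.  It measures how often the difference between the
states can be observed. -/
noncomputable def respDist (T : ObjType.{u}) : T.State → T.State → List T.Op → ℕ
  | _, _, [] => 0
  | s, s', op :: ops =>
    (if (T.apply s op).2 = (T.apply s' op).2 then 0 else 1) +
      T.respDist (T.apply s op).1 (T.apply s' op).1 ops

/-- No sequence of operations observes the difference between the two states more than `k`
times.  In particular, `T.Similar 0` is observational equivalence. -/
def Similar (T : ObjType.{u}) (k : ℕ) (s s' : T.State) : Prop :=
  ∀ ops, T.respDist s s' ops ≤ k

theorem Similar.refl (k : ℕ) (s : T.State) : T.Similar k s s := by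
  intro ops
  induction ops generalizing s with
  | nil => exact Nat.zero_le k
  | cons op ops ih => simpa only [respDist, if_true, zero_add] using ih _

theorem Similar.apply {k : ℕ} {s s' : T.State} (h : T.Similar k s s') (op : T.Op) :
    ((T.apply s op).2 = (T.apply s' op).2 ∧ T.Similar k (T.apply s op).1 (T.apply s' op).1) ∨
      ∃ k', k = k' + 1 ∧ T.Similar k' (T.apply s op).1 (T.apply s' op).1 := by
  by_cases hop : (T.apply s op).2 = (T.apply s' op).2
  · exact .inl ⟨hop, fun ops => by simpa [respDist, hop] using h (op :: ops)⟩
  · have hk : ∀ ops, 1 + T.respDist (T.apply s op).1 (T.apply s' op).1 ops ≤ k := fun ops => by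
      simpa only [respDist, if_neg hop] using h (op :: ops)
    obtain ⟨k', rfl⟩ := Nat.exists_eq_add_of_le' (le_of_add_le_left (hk []))
    exact .inr ⟨k', rfl, fun ops => by have := hk ops; lia⟩

end Similar

section Order

variable {T : ObjType.{u}}

/-- Whether `a` has been applied just before `b` cannot be seen after `b`, not even in the response
to `b`. -/
def Hides (T : ObjType.{u}) (s : T.State) (b a : T.Op) : Prop :=
  T.apply (T.apply s a).1 b = T.apply s b

open Classical in
/-- The order in which `a` and `b` are applied in state `s` affects at most `m` responses, where
the responses to `a` and `b` themselves are included. -/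
def OrderVisibleAtMost (T : ObjType.{u}) (m : ℕ) (s : T.State) (a b : T.Op) : Prop :=
  ∃ k, T.Similar k (T.apply (T.apply s a).1 b).1 (T.apply (T.apply s b).1 a).1 ∧
    k + (if (T.apply s a).2 = (T.apply (T.apply s b).1 a).2 then 0 else 1) +
      (if (T.apply (T.apply s a).1 b).2 = (T.apply s b).2 then 0 else 1) ≤ m

/-- Any two operations that are pending on an object of type `T` either hide one another or have
an order that is visible in at most `m` responses.  This bounds the number of processes that can
find out which of the two operations came first. -/
def ConcealsOrder (T : ObjType.{u}) (m : ℕ) : Prop :=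
  ∀ s a b, T.Hides s b a ∨ T.Hides s a b ∨ T.OrderVisibleAtMost m s a b

theorem OrderVisibleAtMost.of_commute {m : ℕ} {s : T.State} {a b : T.Op}
    (hs : (T.apply (T.apply s a).1 b).1 = (T.apply (T.apply s b).1 a).1)
    (ha : (T.apply s a).2 = (T.apply (T.apply s b).1 a).2)
    (hb : (T.apply (T.apply s a).1 b).2 = (T.apply s b).2) : T.OrderVisibleAtMost m s a b :=
  ⟨0, hs ▸ .refl 0 _, by simp [ha, hb]⟩

end Order

section Pi

variable {ι : Type u} [DecidableEq ι] {T : ι → ObjType.{u}}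

/-- A family of objects, regarded as a single object. -/
abbrev pi (T : ι → ObjType.{u}) : ObjType.{u} where
  State := ∀ i, (T i).State
  Op := Σ i, (T i).Op
  Resp := Σ i, (T i).Resp
  apply s op := (Function.update s op.1 ((T op.1).apply (s op.1) op.2).1,
    ⟨op.1, ((T op.1).apply (s op.1) op.2).2⟩)

theorem Similar.pi_update {k : ℕ} {i : ι} {x x' : (T i).State} (h : (T i).Similar k x x')
    (s : ∀ i, (T i).State) :
    (pi T).Similar k (Function.update s i x) (Function.update s i x') := by
  intro ops
  induction ops generalizing k x x' s with
  | nil => exact Nat.zero_le k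
  | cons op ops ih =>
    obtain ⟨j, op⟩ := op
    rcases eq_or_ne j i with rfl | hji
    · rcases h.apply op with ⟨hresp, hnext⟩ | ⟨k', rfl, hnext⟩
      · simpa [respDist, hresp] using ih hnext s
      · have := ih hnext s
        simp only [respDist, Function.update_self, Function.update_idem]
        split_ifs <;> lia
    · simpa [respDist, hji, Function.update_comm hji] using
        ih h (Function.update s j ((T j).apply (s j) op).1)

theorem ConcealsOrder.pi {m : ℕ} (h : ∀ i, (T i).ConcealsOrder m) :
    (ObjType.pi T).ConcealsOrder m := by
  rintro (s : ∀ i, (T i).State) ⟨i, a⟩ ⟨j, b⟩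
  rcases eq_or_ne i j with rfl | hij
  · rcases h i (s i) a b with hab | hab | ⟨k, hk, hm⟩
    · left
      simp only [Hides] at hab
      simp [Hides, hab]
    · right; left
      simp only [Hides] at hab
      simp [Hides, hab]
    · right; right
      exact ⟨k, by simpa using hk.pi_update s, by convert hm using 4 <;> simp⟩
  · right; right
    apply OrderVisibleAtMost.of_commute
    · simp [hij, hij.symm, Function.update_comm hij]
    · simp [hij]
    · simp [hij.symm]

theorem exists_pi_resp_eq {γ : Type*} (i : ι) (f : (T i).Resp → γ) [Nonempty γ] :
    ∃ g : (pi T).Resp → γ, ∀ x, g ⟨i, x⟩ = f x :=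
  ⟨Function.extend (Sigma.mk i) f fun _ => Classical.arbitrary γ,
    (sigma_mk_injective (β := fun i => (T i).Resp)).extend_apply f _⟩

end Pi

end ObjType

section Examples

theorem register_concealsOrder (W : Type u) (m : ℕ) : (register W).ConcealsOrder m := by
  rintro s (_ | w) b
  · exact .inl rfl
  · rcases b with _ | w'
    · exact .inr (.inl rfl)
    · exact .inl rfl

/-- The two stacks have the same height and differ in at most `k` positions. -/
inductive StackNear {V : Type u} : ℕ → List V → List V → Prop
  | refl (k : ℕ) (s : List V) : StackNear k s s
  | cons (x : V) {k : ℕ} {s s' : List V} : StackNear k s s' → StackNear k (x :: s) (x :: s')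
  | cons_succ (x y : V) {k : ℕ} {s s' : List V} :
      StackNear k s s' → StackNear (k + 1) (x :: s) (y :: s')

theorem StackNear.similar {V : Type u} {k : ℕ} {s s' : List V} (h : StackNear k s s') :
    (stack V).Similar k s s' := by
  intro ops
  induction ops generalizing k s s' with
  | nil => exact Nat.zero_le k
  | cons op ops ih =>
    rcases op with x | _
    · simpa [ObjType.respDist, stack] using ih (h.cons x)
    · cases h with
      | refl => exact ObjType.Similar.refl (T := stack V) k s (.pop :: ops)
      | cons x h => simpa [ObjType.respDist, stack] using ih h
      | cons_succ x y h =>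
        have := ih h
        simp only [ObjType.respDist]
        split_ifs
        · exact (Nat.zero_add _).trans_le (this.trans (Nat.le_succ _))
        · exact (Nat.add_comm _ _).trans_le (Nat.succ_le_succ this)

theorem stack_concealsOrder (V : Type u) : (stack V).ConcealsOrder 2 := by
  have push_pop_visible : ∀ (x z : V) (s : List V),
      (stack V).OrderVisibleAtMost 2 (z :: s : List V) (.push x) .pop := fun x z s =>
    ⟨1, ((StackNear.refl 0 s).cons_succ z x).similar, by
      simp only [stack]; split_ifs <;> simp_all⟩
  have pop_push_visible : ∀ (x z : V) (s : List V),
      (stack V).OrderVisibleAtMost 2 (z :: s : List V) .pop (.push x) := fun x z s =>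
    ⟨1, ((StackNear.refl 0 s).cons_succ x z).similar, by
      simp only [stack]; split_ifs <;> simp_all⟩
  rintro s (x | _) (y | _)
  · exact .inr (.inr ⟨2, (((StackNear.refl 0 s).cons_succ x y).cons_succ y x).similar, by
      simp [stack]⟩)
  · rcases s with _ | ⟨z, s⟩
    · exact .inr (.inl rfl)
    · exact .inr (.inr (push_pop_visible x z s))
  · rcases s with _ | ⟨z, s⟩
    · exact .inl rfl
    · exact .inr (.inr (pop_push_visible y z s))
  · exact .inr (.inr ⟨0, .refl 0 _, by split_ifs <;> simp⟩)

end Examples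

section Schedules

variable {n : ℕ}

/-- The first `t` events of a schedule, listed from the latest to the earliest. -/
def Schedule.past (σ : Schedule n) : ℕ → List (Event n)
  | 0 => []
  | t + 1 => σ t :: Schedule.past σ t

/-- A restriction on crashes: `M h p` means that process `p` may crash right after the history
`h`, which lists the events from the latest to the earliest. -/
abbrev CrashRule (n : ℕ) : Type := List (Event n) → Fin n → Prop

/-- The histories in which all crashes obey the rule `M`. -/
inductive Legal (M : CrashRule n) : List (Event n) → Prop
  | nil : Legal M []
  | step (p : Fin n) {h : List (Event n)} : Legal M h → Legal M (.step p :: h)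
  | crash {p : Fin n} {h : List (Event n)} : Legal M h → M h p → Legal M (.crash p :: h)

/-- Every infinite sequence of events that obeys the rule `M` has a process that takes infinitely
many steps and only finitely often crashes, so that wait-freedom applies to it. -/
def CrashRule.Live (M : CrashRule n) : Prop :=
  ∀ σ : Schedule n, (∀ t, Legal M (σ.past t)) →
    ∃ p, (∀ᶠ t in atTop, σ t ≠ .crash p) ∧ ∃ᶠ t in atTop, σ t = .step p

variable {M : CrashRule n}

theorem Legal.tail {e : Event n} {h : List (Event n)} (H : Legal M (e :: h)) : Legal M h := by
  cases H <;> assumption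

theorem Legal.drop {h : List (Event n)} (H : Legal M h) (i : ℕ) : Legal M (h.drop i) := by
  induction i generalizing h with
  | zero => exact H
  | succ i ih =>
    cases h with
    | nil => exact H
    | cons e h => exact ih H.tail

theorem Legal.steps_append {h w : List (Event n)} (H : Legal M h)
    (hw : ∀ e ∈ w, ∃ p, e = .step p) : Legal M (w ++ h) := by
  induction w with
  | nil => exact H
  | cons e w ih =>
    obtain ⟨⟨p, rfl⟩, hsteps⟩ := List.forall_mem_cons.1 hw
    exact (ih hsteps).step p

theorem Legal.replicate_step_append {h : List (Event n)} (H : Legal M h) (p : Fin n) (j : ℕ) :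
    Legal M (List.replicate j (.step p) ++ h) :=
  H.steps_append fun _ he => ⟨p, List.eq_of_mem_replicate he⟩

theorem Legal.rule_of_eq_crash {σ : Schedule n} (H : ∀ t, Legal M (σ.past t)) {t : ℕ} {p : Fin n}
    (ht : σ t = .crash p) : M (σ.past t) p := by
  have := H (t + 1)
  rw [Schedule.past, ht] at this
  cases this
  assumption

theorem Schedule.past_getD_reverse (h : List (Event n)) (e : Event n) (t : ℕ) :
    Schedule.past (fun s => h.reverse.getD s e) t =
      List.replicate (t - h.length) e ++ h.drop (h.length - t) := by
  induction t with
  | zero => simp [Schedule.past]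
  | succ t ih =>
    rw [Schedule.past, ih]
    rcases lt_or_ge t h.length with ht | ht
    · rw [show h.length - t = h.length - (t + 1) + 1 by lia,
        List.drop_eq_getElem_cons (i := h.length - (t + 1)) (by lia)]
      simp [ht, ht.le, Nat.succ_le_of_lt ht, Nat.sub_sub, Nat.add_comm]
    · simp [ht, Nat.succ_sub ht, List.replicate_succ, Nat.le_succ_of_le ht]

theorem Schedule.past_eq_drop (σ : Schedule n) (t s : ℕ) :
    σ.past s = (σ.past (t + s)).drop t := by
  induction t with
  | zero => rw [Nat.zero_add, List.drop_zero]
  | succ t ih => rw [ih, Nat.succ_add, Schedule.past, List.drop_succ_cons]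

theorem Legal.exists_schedule {h : List (Event n)} (H : Legal M h) (p : Fin n) :
    ∃ σ : Schedule n, (∀ t, Legal M (σ.past t)) ∧ (∀ t ≥ h.length, σ t = .step p) ∧
      ∀ j, σ.past (j + h.length) = List.replicate j (.step p) ++ h := by
  refine ⟨fun s => h.reverse.getD s (.step p), fun t => ?_, fun t ht => ?_, fun j => ?_⟩
  · rw [Schedule.past_getD_reverse]
    exact (H.drop _).replicate_step_append p _
  · simp [ht]
  · rw [Schedule.past_getD_reverse]; simp

theorem exists_frequently_step {σ : Schedule n} (h : ∀ᶠ t in atTop, ∀ p, σ t ≠ .crash p) :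
    ∃ p, ∃ᶠ t in atTop, σ t = .step p := by
  by_contra! hstep
  obtain ⟨t, hcrash, hstep⟩ := (h.and (eventually_all.2 hstep)).exists
  rcases ht : σ t with p | p
  · exact hstep p ht
  · exact hcrash p ht

/-- No process may crash. -/
def CrashRule.crashFree : CrashRule n := fun _ _ => False

theorem legal_crashFree_iff {σ : Schedule n} :
    (∀ t, Legal .crashFree (σ.past t)) ↔ ∀ t p, σ t ≠ .crash p := by
  refine ⟨fun H t p ht => Legal.rule_of_eq_crash H ht, fun H t => ?_⟩
  induction t with
  | zero => exact .nil
  | succ t ih =>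
    rw [Schedule.past]
    rcases ht : σ t with p | p
    · exact ih.step p
    · exact (H t p ht).elim

theorem CrashRule.live_crashFree : (crashFree : CrashRule n).Live := fun _ H =>
  have hcrash := legal_crashFree_iff.1 H
  (exists_frequently_step (.of_forall hcrash)).imp fun p hp =>
    ⟨.of_forall fun t => hcrash t p, hp⟩

/-- A process may crash only if a process of lower index has taken a step since the last crash of
any process. -/
def CrashRule.afterLowerStep : CrashRule n
  | [], _ => False
  | .step p :: h, q => p < q ∨ afterLowerStep h q
  | .crash _ :: _, _ => False

theorem CrashRule.afterLowerStep.steps_append {h w : List (Event n)} {q : Fin n}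
    (H : afterLowerStep h q) (hw : ∀ e ∈ w, ∃ p, e = .step p) : afterLowerStep (w ++ h) q := by
  induction w with
  | nil => exact H
  | cons e w ih =>
    obtain ⟨⟨p, rfl⟩, hsteps⟩ := List.forall_mem_cons.1 hw
    exact .inr (ih hsteps)

theorem CrashRule.afterLowerStep.exists_step_lt {σ : Schedule n} {q r : Fin n} {s t : ℕ}
    (H : afterLowerStep (σ.past t) q) (hs : σ s = .crash r) (hst : s < t) :
    ∃ i ≥ s, ∃ p < q, σ i = .step p := by
  induction t with
  | zero => exact H.elim
  | succ t ih =>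
    rw [Schedule.past] at H
    rcases ht : σ t with p | p <;> rw [ht] at H
    · rcases H with hpq | H
      · exact ⟨t, Nat.le_of_lt_succ hst, p, hpq, ht⟩
      · refine ih H ((Nat.le_of_lt_succ hst).lt_of_ne ?_)
        rintro rfl
        cases ht.symm.trans hs
    · exact H.elim

theorem exists_lt_frequently_step {σ : Schedule n} (H : ∀ t, Legal .afterLowerStep (σ.past t))
    {q : Fin n} (hq : ∃ᶠ t in atTop, σ t = .crash q) : ∃ p < q, ∃ᶠ t in atTop, σ t = .step p := by
  by_contra! hstep
  obtain ⟨t₀, ht₀⟩ := eventually_atTop.1 ((eventually_all_finite (Set.finite_Iio q)).2 hstep)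
  obtain ⟨s, hs, hsq⟩ := frequently_atTop.1 hq t₀
  obtain ⟨t, ht, htq⟩ := frequently_atTop.1 hq (s + 1)
  obtain ⟨i, hi, p, hpq, hip⟩ := (Legal.rule_of_eq_crash H htq).exists_step_lt hsq ht
  exact ht₀ i (hs.trans hi) p hpq hip

/-- The lowest process that takes infinitely many steps crashes only finitely often. -/
theorem CrashRule.live_afterLowerStep : (afterLowerStep : CrashRule n).Live := by
  intro σ H
  obtain ⟨p₀, hp₀⟩ : ∃ p, ∃ᶠ t in atTop, σ t = .step p := by
    by_cases hcrash : ∀ᶠ t in atTop, ∀ p, σ t ≠ .crash p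
    · exact exists_frequently_step hcrash
    · rw [eventually_all, not_forall] at hcrash
      obtain ⟨q, hq⟩ := hcrash
      obtain ⟨p, -, hp⟩ := exists_lt_frequently_step H hq
      exact ⟨p, hp⟩
  obtain ⟨p, hp, hmin⟩ := wellFounded_lt.has_min {p | ∃ᶠ t in atTop, σ t = .step p} ⟨p₀, hp₀⟩
  refine ⟨p, ?_, hp⟩
  by_contra hcrash
  obtain ⟨r, hrp, hr⟩ := exists_lt_frequently_step H hcrash
  exact hmin r hr hrp

end Schedules

namespace Algorithm

section Histories

variable {T : ObjType.{u}} {n : ℕ} {D : Type u} {A : Algorithm T n D} {M : CrashRule n}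
  {inp : Fin n → D} {h w : List (Event n)} {p q : Fin n} {u v : D}

/-- The configuration reached by a history, which lists the events from the latest to the
earliest. -/
noncomputable def after (A : Algorithm T n D) (inp : Fin n → D) : List (Event n) → A.Config
  | [] => A.initial inp
  | e :: h => A.exec inp (A.after inp h) e

/-- The process `p` has output `v` in its current run. -/
def OutputsIn (A : Algorithm T n D) (c : A.Config) (p : Fin n) (v : D) : Prop :=
  A.next p (c.loc p) = .output v

/-- `A` solves consensus in all executions whose crashes obey the rule `M`. -/
def SolvesUnder (A : Algorithm T n D) (M : CrashRule n) : Prop :=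
  ∀ inp σ, (∀ t, Legal M (Schedule.past σ t)) →
    A.Agreement inp σ ∧ A.Validity inp σ ∧ A.WaitFree inp σ

/-- `v` is the only value that can be output from the history `h` on. -/
def Valent (A : Algorithm T n D) (M : CrashRule n) (inp : Fin n → D) (h : List (Event n))
    (v : D) : Prop :=
  ∀ w, Legal M (w ++ h) → ∀ p u, A.OutputsIn (A.after inp (w ++ h)) p u → u = v

theorem configAt_eq_after (σ : Schedule n) (t : ℕ) :
    A.configAt inp σ t = A.after inp (σ.past t) := by
  induction t with
  | zero => rfl
  | succ t ih => rw [configAt, ih]; rfl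

theorem outputs_iff {σ : Schedule n} {t : ℕ} :
    A.Outputs inp σ t p v ↔ A.OutputsIn (A.after inp (σ.past t)) p v := by
  rw [Outputs, configAt_eq_after, OutputsIn]

theorem SolvesUnder.valent_of_outputsIn (hA : A.SolvesUnder M)
    (hv : A.OutputsIn (A.after inp h) p v) : A.Valent M inp h v := by
  intro w H q u hu
  obtain ⟨σ, Hσ, -, hpast⟩ := H.exists_schedule p
  have hwh : σ.past (w ++ h).length = w ++ h := by simpa using hpast 0
  have hh : σ.past h.length = h := by
    rw [σ.past_eq_drop w.length, ← List.length_append, hwh, List.drop_left]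
  exact (hA inp σ Hσ).1 _ _ _ _ _ _ (outputs_iff.2 (hwh.symm ▸ hu)) (outputs_iff.2 (hh.symm ▸ hv))

theorem SolvesUnder.exists_eq_of_outputsIn (hA : A.SolvesUnder M) (H : Legal M h)
    (hv : A.OutputsIn (A.after inp h) p v) : ∃ q, inp q = v := by
  obtain ⟨σ, Hσ, -, hpast⟩ := H.exists_schedule p
  have hh : σ.past h.length = h := by simpa using hpast 0
  exact (hA inp σ Hσ).2.1 _ _ _ (outputs_iff.2 (hh.symm ▸ hv))

theorem SolvesUnder.exists_outputsIn_solo (hA : A.SolvesUnder M) (H : Legal M h)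
    (inp : Fin n → D) (p : Fin n) :
    ∃ j v, A.OutputsIn (A.after inp (List.replicate j (.step p) ++ h)) p v := by
  obtain ⟨σ, Hσ, hsolo, hpast⟩ := H.exists_schedule p
  obtain ⟨t, v, ht, hv⟩ := (hA inp σ Hσ).2.2 p h.length (fun t ht => by simp [hsolo t ht])
    fun s => ⟨max s h.length, le_max_left _ _, hsolo _ (le_max_right _ _)⟩
  obtain ⟨j, rfl⟩ := Nat.exists_eq_add_of_le' ht
  exact ⟨j, v, hpast j ▸ outputs_iff.1 hv⟩

theorem Valent.append (hv : A.Valent M inp h v) (w : List (Event n)) :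
    A.Valent M inp (w ++ h) v := fun w' H =>
  List.append_assoc w' w h ▸ hv (w' ++ w) (List.append_assoc w' w h ▸ H)

theorem Valent.cons (hv : A.Valent M inp h v) (e : Event n) : A.Valent M inp (e :: h) v :=
  hv.append [e]

end Histories

section Indistinguishability

variable {T : ObjType.{u}} {n : ℕ} {D : Type u} {A : Algorithm T n D} {M : CrashRule n}
  {inp inp' : Fin n → D} {h h' : List (Event n)} {p : Fin n} {v v' : D}
  {c c' : A.Config} {S : Finset (Fin n)} {k : ℕ}

/-- The types of the shared objects of `A`, registers included. -/
abbrev objectType (A : Algorithm T n D) : A.Obj ⊕ A.Reg → ObjType.{u} :=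
  Sum.elim (fun _ => T) fun _ => register A.RegVal

open Classical in
/-- The type of the single object that consists of all shared objects of `A`. -/
noncomputable abbrev memoryType (A : Algorithm T n D) : ObjType.{u} :=
  ObjType.pi A.objectType

/-- The states of all shared objects, as the state of a single object. -/
noncomputable def Config.memory (c : A.Config) : A.memoryType.State :=
  Sum.rec c.obj c.reg

/-- The memories are `k`-similar, and each process of `S` is in the same local state. -/
def Alike (A : Algorithm T n D) (k : ℕ) (S : Finset (Fin n)) (c c' : A.Config) : Prop :=
  A.memoryType.Similar k c.memory c'.memory ∧ ∀ p ∈ S, c.loc p = c'.loc p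

theorem OutputsIn.exec_step (hv : A.OutputsIn c p v) : A.exec inp c (.step p) = c := by
  rw [OutputsIn] at hv
  simp only [exec, hv]

/-- In the local state `l`, process `p` applies the operation `op` to the memory and passes to the
local state that `next` assigns to the response. -/
def Invokes (A : Algorithm T n D) (p : Fin n) (l : A.Loc) (op : A.memoryType.Op)
    (next : A.memoryType.Resp → A.Loc) : Prop :=
  ∀ inp (c : A.Config), c.loc p = l →
    (A.exec inp c (.step p)).memory = (A.memoryType.apply c.memory op).1 ∧
      (A.exec inp c (.step p)).loc =
        Function.update c.loc p (next (A.memoryType.apply c.memory op).2)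

theorem exists_invokes {l : A.Loc} (hl : ∀ v, A.next p l ≠ .output v) :
    ∃ op next, A.Invokes p l op next := by
  classical
  have : Nonempty A.Loc := ⟨l⟩
  let State (i : A.Obj ⊕ A.Reg) : Type u := (A.objectType i).State
  rcases hnext : A.next p l with v | ⟨o, op, next⟩ | ⟨r, op, next⟩
  · exact (hl v hnext).elim
  · obtain ⟨next', hnext'⟩ := ObjType.exists_pi_resp_eq (T := A.objectType) (.inl o) next
    refine ⟨⟨.inl o, op⟩, next', ?_⟩
    rintro inp c rfl
    simp only [exec, hnext]
    exact ⟨Sum.rec_update_left (γ := State) c.obj c.reg o _, congrArg _ (hnext' _).symm⟩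
  · obtain ⟨next', hnext'⟩ := ObjType.exists_pi_resp_eq (T := A.objectType) (.inr r) next
    refine ⟨⟨.inr r, op⟩, next', ?_⟩
    rintro inp c rfl
    simp only [exec, hnext]
    exact ⟨Sum.rec_update_right (γ := State) c.obj c.reg r _, congrArg _ (hnext' _).symm⟩

theorem Alike.exec_step (H : A.Alike k S c c') (hp : p ∈ S) :
    A.Alike k S (A.exec inp c (.step p)) (A.exec inp' c' (.step p)) ∨
      ∃ k', k = k' + 1 ∧
        A.Alike k' (S.erase p) (A.exec inp c (.step p)) (A.exec inp' c' (.step p)) := by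
  by_cases hout : ∃ v, A.OutputsIn c p v
  · obtain ⟨v, hv⟩ := hout
    have hv' : A.OutputsIn c' p v := by rwa [OutputsIn, ← H.2 p hp]
    exact .inl (by rwa [hv.exec_step, hv'.exec_step])
  obtain ⟨op, next, hstep⟩ := exists_invokes (not_exists.1 hout)
  obtain ⟨hmem, hloc⟩ := hstep inp c rfl
  obtain ⟨hmem', hloc'⟩ := hstep inp' c' (H.2 p hp).symm
  rcases H.1.apply op with ⟨hresp, hsim⟩ | ⟨k', rfl, hsim⟩
  · refine .inl ⟨by rwa [hmem, hmem'], fun r hr => ?_⟩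
    rw [hloc, hloc', hresp]
    simp only [Function.update_apply, H.2 r hr]
  · refine .inr ⟨k', rfl, by rwa [hmem, hmem'], fun r hr => ?_⟩
    obtain ⟨hrp, hr⟩ := Finset.mem_erase.1 hr
    rw [hloc, hloc', Function.update_of_ne hrp, Function.update_of_ne hrp, H.2 r hr]

theorem Alike.crash (H : A.Alike k S c c') (r : Fin n) :
    A.Alike k {r} (A.exec inp c (.crash r)) (A.exec inp c' (.crash r)) := by
  refine ⟨H.1, fun s hs => ?_⟩
  rw [Finset.mem_singleton.1 hs]
  simp only [exec, Function.update_self]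

theorem Alike.solo (H : A.Alike k S (A.after inp h) (A.after inp' h')) (hp : p ∈ S) (j : ℕ) :
    A.Alike k S (A.after inp (List.replicate j (.step p) ++ h))
        (A.after inp' (List.replicate j (.step p) ++ h')) ∨
      ∃ k' i, k = k' + 1 ∧ A.Alike k' (S.erase p) (A.after inp (List.replicate i (.step p) ++ h))
        (A.after inp' (List.replicate i (.step p) ++ h')) := by
  induction j with
  | zero => exact .inl H
  | succ j ih =>
    refine ih.elim (fun hj => ?_) .inr
    exact (hj.exec_step hp).imp_right fun ⟨k', hk, H'⟩ => ⟨k', j + 1, hk, H'⟩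

theorem SolvesUnder.eq_or_exists_alike_erase (hA : A.SolvesUnder M) (hh : Legal M h)
    (hh' : Legal M h') (hv : A.Valent M inp h v) (hv' : A.Valent M inp' h' v')
    (H : A.Alike k S (A.after inp h) (A.after inp' h')) (hp : p ∈ S) :
    v = v' ∨ ∃ k' i, k = k' + 1 ∧
      A.Alike k' (S.erase p) (A.after inp (List.replicate i (.step p) ++ h))
        (A.after inp' (List.replicate i (.step p) ++ h')) := by
  obtain ⟨j, u, hu⟩ := hA.exists_outputsIn_solo hh inp p
  refine (H.solo hp j).imp_left fun H => ?_
  have hu' : A.OutputsIn (A.after inp' (List.replicate j (.step p) ++ h')) p u := by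
    rwa [OutputsIn, ← H.2 p hp]
  rw [← hv _ (hh.replicate_step_append p j) p u hu,
    ← hv' _ (hh'.replicate_step_append p j) p u hu']

theorem SolvesUnder.eq_of_alike_zero (hA : A.SolvesUnder M) (hh : Legal M h)
    (hh' : Legal M h') (hv : A.Valent M inp h v) (hv' : A.Valent M inp' h' v')
    (H : A.Alike 0 S (A.after inp h) (A.after inp' h')) (hp : p ∈ S) : v = v' :=
  (hA.eq_or_exists_alike_erase hh hh' hv hv' H hp).resolve_right fun ⟨_, _, hk, _⟩ =>
    Nat.succ_ne_zero _ hk.symm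

/-- Letting processes of `S` run solo, one after another, uses up the `k` differences. -/
theorem SolvesUnder.eq_or_exists_alike_zero (hA : A.SolvesUnder M) (hh : Legal M h)
    (hh' : Legal M h') (hv : A.Valent M inp h v) (hv' : A.Valent M inp' h' v')
    (H : A.Alike k S (A.after inp h) (A.after inp' h')) (hk : k ≤ S.card) :
    v = v' ∨ ∃ (w : List (Event n)) (S' : Finset (Fin n)),
      (∀ e ∈ w, ∃ p, e = .step p) ∧ S.card ≤ S'.card + k ∧
        A.Alike 0 S' (A.after inp (w ++ h)) (A.after inp' (w ++ h')) := by
  induction k generalizing S h h' with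
  | zero => exact .inr ⟨[], S, by simp, le_rfl, H⟩
  | succ k ih =>
    obtain ⟨p, hp⟩ : S.Nonempty := Finset.card_pos.1 (Nat.zero_lt_of_lt hk)
    refine (hA.eq_or_exists_alike_erase hh hh' hv hv' H hp).elim .inl ?_
    rintro ⟨_, i, ⟨rfl⟩, H⟩
    have hcard := Finset.card_erase_add_one hp
    refine (ih (hh.replicate_step_append p i) (hh'.replicate_step_append p i) (hv.append _)
      (hv'.append _) H (by lia)).imp_right ?_
    rintro ⟨w, S', hw, hS', H⟩
    refine ⟨w ++ List.replicate i (.step p), S', fun e he => ?_, by lia, by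
      rwa [List.append_assoc, List.append_assoc]⟩
    exact (List.mem_append.1 he).elim (hw e) fun he => ⟨p, List.eq_of_mem_replicate he⟩

end Indistinguishability

section Bivalence

variable {T : ObjType.{u}} {n : ℕ} {D : Type u} {A : Algorithm T n D} {M : CrashRule n}
  {inp : Fin n → D} {h : List (Event n)}

theorem SolvesUnder.valent_const (hA : A.SolvesUnder M) (h : List (Event n)) (v : D) :
    A.Valent M (fun _ => v) h v := fun _ H _ _ hu =>
  let ⟨_, hv⟩ := hA.exists_eq_of_outputsIn H hu
  hv.symm

/-- A process running alone from the start cannot tell the inputs from the constant ones. -/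
theorem SolvesUnder.eq_input_of_valent_nil (hA : A.SolvesUnder M) {v : D}
    (hv : A.Valent M inp [] v) (p : Fin n) : v = inp p :=
  hA.eq_of_alike_zero (S := {p}) .nil .nil hv (hA.valent_const [] (inp p))
    ⟨.refl 0 _, fun q hq => by rw [Finset.mem_singleton.1 hq]; rfl⟩ (Finset.mem_singleton_self p)

/-- The history `h` is undecided, but every event decides. -/
def Critical (A : Algorithm T n D) (M : CrashRule n) (inp : Fin n → D) (h : List (Event n)) :
    Prop :=
  Legal M h ∧ (∀ v, ¬ A.Valent M inp h v) ∧ ∀ e, Legal M (e :: h) → ∃ v, A.Valent M inp (e :: h) v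

theorem SolvesUnder.exists_critical (hA : A.SolvesUnder M) (hM : M.Live)
    (h₀ : ∀ v, ¬ A.Valent M inp [] v) : ∃ h, A.Critical M inp h := by
  by_contra! hcrit
  let Undecided := {h : List (Event n) // Legal M h ∧ ∀ v, ¬ A.Valent M inp h v}
  have hext (h : Undecided) : ∃ e, Legal M (e :: h.1) ∧ ∀ v, ¬ A.Valent M inp (e :: h.1) v := by
    by_contra! hext
    exact hcrit h.1 ⟨h.2.1, h.2.2, hext⟩
  choose e he using hext
  let history : ℕ → Undecided := fun t => Nat.rec ⟨[], .nil, h₀⟩ (fun _ h => ⟨e h :: h.1, he h⟩) t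
  let σ : Schedule n := fun t => e (history t)
  have hpast (t : ℕ) : σ.past t = (history t).1 := by
    induction t with
    | zero => rfl
    | succ t ih => rw [Schedule.past, ih]
  have hσ (t : ℕ) : Legal M (σ.past t) := hpast t ▸ (history t).2.1
  obtain ⟨p, hcrash, hstep⟩ := hM σ hσ
  obtain ⟨t₀, ht₀⟩ := eventually_atTop.1 hcrash
  obtain ⟨t, v, -, hv⟩ := (hA inp σ hσ).2.2 p t₀ ht₀ (frequently_atTop.1 hstep)
  exact (history t).2.2 v (hpast t ▸ hA.valent_of_outputsIn (outputs_iff.1 hv))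

theorem Critical.not_outputsIn (hA : A.SolvesUnder M) (hc : A.Critical M inp h) (p : Fin n)
    (v : D) : ¬ A.OutputsIn (A.after inp h) p v := fun hv =>
  hc.2.1 v (hA.valent_of_outputsIn hv)

/-- The process `p` does not notice that `r` has just crashed. -/
theorem SolvesUnder.eq_of_valent_crash (hA : A.SolvesUnder M) {p r : Fin n} (hpr : p ≠ r) {v v' : D}
    (H : Legal M (.crash r :: h)) (hv : A.Valent M inp (.step p :: h) v)
    (hv' : A.Valent M inp (.crash r :: h) v') : v = v' := by
  have hp := Finset.mem_singleton_self p
  have H₀ : A.Alike 0 {p} (A.after inp h) (A.after inp (.crash r :: h)) := by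
    refine ⟨.refl 0 _, fun q hq => (Function.update_of_ne ?_ _ _).symm⟩
    rwa [Finset.mem_singleton.1 hq]
  have H₁ : A.Alike 0 {p} (A.after inp (.step p :: h)) (A.after inp (.step p :: .crash r :: h)) :=
    (H₀.exec_step hp).resolve_right fun ⟨_, hk, _⟩ => Nat.succ_ne_zero _ hk.symm
  exact hA.eq_of_alike_zero (H.tail.step p) (H.step p) hv (hv'.cons _) H₁ hp

theorem valent_of_forall_cons {v : D} (hout : ∀ p u, ¬ A.OutputsIn (A.after inp h) p u)
    (hcons : ∀ e, Legal M (e :: h) → A.Valent M inp (e :: h) v) : A.Valent M inp h v := by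
  intro w H p u hu
  rcases w.eq_nil_or_concat' with rfl | ⟨w, e, rfl⟩
  · exact (hout p u hu).elim
  · rw [List.append_assoc, List.singleton_append] at H hu
    exact hcons e (by simpa only [List.drop_left] using H.drop w.length) w H p u hu

theorem Critical.exists_ne_step [Nontrivial (Fin n)] (hA : A.SolvesUnder M)
    (hc : A.Critical M inp h) : ∃ p q v v', p ≠ q ∧ v ≠ v' ∧
      A.Valent M inp (.step p :: h) v ∧ A.Valent M inp (.step q :: h) v' := by
  choose v hv using fun p => hc.2.2 (.step p) (hc.1.step p)
  suffices ∃ p q, v p ≠ v q from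
    let ⟨p, q, hpq⟩ := this
    ⟨p, q, v p, v q, ne_of_apply_ne v hpq, hpq, hv p, hv q⟩
  by_contra! hconst
  obtain ⟨p⟩ : Nonempty (Fin n) := inferInstance
  refine hc.2.1 (v p) (valent_of_forall_cons (hc.not_outputsIn hA) ?_)
  rintro (q | r) H
  · exact hconst p q ▸ hv q
  · obtain ⟨q, hqr⟩ := exists_ne r
    obtain ⟨u, hu⟩ := hc.2.2 _ H
    rwa [hconst p q, hA.eq_of_valent_crash hqr H (hv q) hu]

open Classical in
theorem card_le_card_filter_eq_add {α β : Type*} [Fintype α] {f g : α → β} {a b : α} {P Q : Prop}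
    (h : ∀ x, x ≠ a → x ≠ b → f x = g x) (ha : P → f a = g a) (hb : Q → f b = g b) :
    Fintype.card α ≤ (Finset.univ.filter fun x => f x = g x).card + (if P then 0 else 1) +
      if Q then 0 else 1 := by
  have hcover : Finset.univ ⊆ (Finset.univ.filter fun x => f x = g x) ∪
      (if P then ∅ else {a}) ∪ if Q then ∅ else {b} := fun x _ => by
    rcases eq_or_ne x a with rfl | hxa
    · by_cases hP : P <;> simp [hP, ha]
    rcases eq_or_ne x b with rfl | hxb
    · by_cases hQ : Q <;> simp [hQ, hb]
    · simp [h x hxa hxb]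
  refine (Finset.card_le_card hcover).trans ((Finset.card_union_le _ _).trans (add_le_add
    ((Finset.card_union_le _ _).trans (add_le_add le_rfl ?_)) ?_)) <;>
  split_ifs <;> simp

open Classical in
/-- In the last case, at most `m` processes can tell the two orders apart: those outside `S`, from
their local states, and `k` more from future responses. -/
theorem exists_alike_swap {m : ℕ} (hT : A.memoryType.ConcealsOrder m) {c : A.Config}
    {p q : Fin n} (hpq : p ≠ q) (hp : ∀ v, ¬ A.OutputsIn c p v) (hq : ∀ v, ¬ A.OutputsIn c q v) :
    A.Alike 0 {q} (A.exec inp (A.exec inp c (.step p)) (.step q)) (A.exec inp c (.step q)) ∨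
      A.Alike 0 {p} (A.exec inp (A.exec inp c (.step q)) (.step p)) (A.exec inp c (.step p)) ∨
      ∃ k S, n + k ≤ m + S.card ∧
        A.Alike k S (A.exec inp (A.exec inp c (.step p)) (.step q))
          (A.exec inp (A.exec inp c (.step q)) (.step p)) := by
  obtain ⟨a, nextp, hp⟩ := exists_invokes hp
  obtain ⟨b, nextq, hq⟩ := exists_invokes hq
  obtain ⟨hmp, hlp⟩ := hp inp c rfl
  obtain ⟨hmq, hlq⟩ := hq inp c rfl
  obtain ⟨hmpq, hlpq⟩ := hq inp (A.exec inp c (.step p))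
    (by rw [hlp, Function.update_of_ne hpq.symm])
  obtain ⟨hmqp, hlqp⟩ := hp inp (A.exec inp c (.step q)) (by rw [hlq, Function.update_of_ne hpq])
  rw [hmp, hlp] at hlpq
  rw [hmq, hlq] at hlqp
  rw [hmp] at hmpq
  rw [hmq] at hmqp
  rcases hT c.memory a b with hab | hba | ⟨k, hk, hm⟩
  · left
    rw [ObjType.Hides] at hab
    refine ⟨by rw [hmpq, hmq, hab]; exact .refl 0 _, fun r hr => ?_⟩
    rw [hlpq, hlq, hab, Finset.mem_singleton.1 hr, Function.update_self, Function.update_self]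
  · right; left
    rw [ObjType.Hides] at hba
    refine ⟨by rw [hmqp, hmp, hba]; exact .refl 0 _, fun r hr => ?_⟩
    rw [hlqp, hlp, hba, Finset.mem_singleton.1 hr, Function.update_self, Function.update_self]
  · right; right
    refine ⟨k, Finset.univ.filter fun r => _ = _, ?_, by rwa [hmpq, hmqp],
      fun r hr => (Finset.mem_filter.1 hr).2⟩
    have hcard := card_le_card_filter_eq_add (a := p) (b := q)
      (f := (A.exec inp (A.exec inp c (.step p)) (.step q)).loc)
      (g := (A.exec inp (A.exec inp c (.step q)) (.step p)).loc)
      (fun r hrp hrq => by simp [hlpq, hlqp, hrp, hrq])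
      (P := (A.memoryType.apply c.memory a).2 =
        (A.memoryType.apply (A.memoryType.apply c.memory b).1 a).2)
      (Q := (A.memoryType.apply (A.memoryType.apply c.memory a).1 b).2 =
        (A.memoryType.apply c.memory b).2)
      (fun h => by rw [hlpq, hlqp, Function.update_of_ne hpq, Function.update_self,
        Function.update_self, h])
      (fun h => by rw [hlpq, hlqp, Function.update_of_ne hpq.symm, Function.update_self,
        Function.update_self, h])
    rw [Fintype.card_fin] at hcard
    lia

end Bivalence

section Impossibility

variable {T : ObjType.{u}} {n m : ℕ} {D : Type u} {A : Algorithm T n D} {M : CrashRule n}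

theorem SolvesUnder.exists_alike_of_ne_valent [Nontrivial (Fin n)] [Nontrivial D]
    (hA : A.SolvesUnder M) (hM : M.Live) (hT : A.memoryType.ConcealsOrder m) :
    ∃ inp h p q v v' k S, p ≠ q ∧ v ≠ v' ∧ Legal M h ∧
      A.Valent M inp (.step q :: .step p :: h) v ∧ A.Valent M inp (.step p :: .step q :: h) v' ∧
      A.Alike k S (A.after inp (.step q :: .step p :: h)) (A.after inp (.step p :: .step q :: h)) ∧
      n + k ≤ m + S.card := by
  obtain ⟨a, b, hab⟩ := exists_pair_ne D
  obtain ⟨p₀, p₁, hp⟩ := exists_pair_ne (Fin n)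
  let inp : Fin n → D := Function.update (fun _ => b) p₀ a
  have h₀ : ∀ v, ¬ A.Valent M inp [] v := fun v hv => hab <| by
    rw [← (hA.eq_input_of_valent_nil hv p₀).trans (Function.update_self ..),
      hA.eq_input_of_valent_nil hv p₁]
    exact Function.update_of_ne hp.symm _ _
  obtain ⟨h, hc⟩ := hA.exists_critical hM h₀
  obtain ⟨p, q, v, v', hpq, hvv', hv, hv'⟩ := hc.exists_ne_step hA
  have hLp := hc.1.step p
  have hLq := hc.1.step q
  rcases exists_alike_swap hT (inp := inp) hpq (hc.not_outputsIn hA p)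
    (hc.not_outputsIn hA q) with H | H | ⟨k, S, hcard, H⟩
  · exact (hvv' (hA.eq_of_alike_zero (hLp.step q) hLq (hv.cons _) hv' H
      (Finset.mem_singleton_self q))).elim
  · exact (hvv' (hA.eq_of_alike_zero (hLq.step p) hLp (hv'.cons _) hv H
      (Finset.mem_singleton_self p)).symm).elim
  · exact ⟨inp, h, p, q, v, v', k, S, hpq, hvv', hc.1, hv.cons _, hv'.cons _, H, hcard⟩

theorem memoryType_concealsOrder (hT : T.ConcealsOrder m) (A : Algorithm T n D) :
    A.memoryType.ConcealsOrder m := by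
  classical
  exact .pi (Sum.rec (fun _ => hT) fun _ => register_concealsOrder _ m)

theorem not_solvesUnder_of_concealsOrder [Nontrivial (Fin n)] [Nontrivial D] (hM : M.Live)
    (hT : T.ConcealsOrder m) (hmn : m < n) : ¬ A.SolvesUnder M := fun hA => by
  obtain ⟨inp, h, p, q, v, v', k, S, -, hvv', H, hv, hv', hS, hcard⟩ :=
    hA.exists_alike_of_ne_valent hM (memoryType_concealsOrder hT A)
  have hpq := (H.step p).step q
  have hqp := (H.step q).step p
  obtain ⟨w, S', hw, hS', hS⟩ :=
    (hA.eq_or_exists_alike_zero hpq hqp hv hv' hS (by lia)).resolve_left hvv'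
  obtain ⟨r, hr⟩ : S'.Nonempty := Finset.card_pos.1 (by lia)
  exact hvv' (hA.eq_of_alike_zero (hpq.steps_append hw) (hqp.steps_append hw) (hv.append w)
    (hv'.append w) hS hr)

/-- The missing process is supplied by a crash, which erases what it knows. -/
theorem not_solvesUnder_afterLowerStep [Nontrivial (Fin n)] [Nontrivial D]
    (hT : T.ConcealsOrder m) (hmn : m ≤ n) : ¬ A.SolvesUnder .afterLowerStep := fun hA => by
  obtain ⟨inp, h, p, q, v, v', k, S, hne, hvv', H, hv, hv', hS, hcard⟩ :=
    hA.exists_alike_of_ne_valent CrashRule.live_afterLowerStep (memoryType_concealsOrder hT A)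
  have hpq := (H.step p).step q
  have hqp := (H.step q).step p
  obtain ⟨w, S', hw, -, hS⟩ :=
    (hA.eq_or_exists_alike_zero hpq hqp hv hv' hS (by lia)).resolve_left hvv'
  obtain ⟨r, hr, hr'⟩ : ∃ r, CrashRule.afterLowerStep (.step q :: .step p :: h) r ∧
      CrashRule.afterLowerStep (.step p :: .step q :: h) r := by
    rcases hne.lt_or_gt with hlt | hlt
    · exact ⟨q, .inr (.inl hlt), .inl hlt⟩
    · exact ⟨p, .inl hlt, .inr (.inl hlt)⟩
  exact hvv' (hA.eq_of_alike_zero ((hpq.steps_append hw).crash (hr.steps_append hw))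
    ((hqp.steps_append hw).crash (hr'.steps_append hw)) ((hv.append w).cons _)
    ((hv'.append w).cons _) (hS.crash r) (Finset.mem_singleton_self r))

theorem SolvesConsensus.solvesUnder (hA : A.SolvesConsensus) : A.SolvesUnder .crashFree :=
  fun inp σ H => hA inp σ (legal_crashFree_iff.1 H)

theorem SolvesRC.solvesUnder (hA : A.SolvesRC) (M : CrashRule n) : A.SolvesUnder M :=
  fun inp σ _ => hA inp σ

end Impossibility

section Steps

variable {T : ObjType.{u}} {n : ℕ} {D : Type u} {A : Algorithm T n D} {inp : Fin n → D}
  {c : A.Config} {p : Fin n}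

open Classical in
theorem exec_step_of_onObj {o : A.Obj} {op : T.Op} {next : T.Resp → A.Loc}
    (hnext : A.next p (c.loc p) = .onObj o op next) :
    (A.exec inp c (.step p)).loc = Function.update c.loc p (next (T.apply (c.obj o) op).2) ∧
      (A.exec inp c (.step p)).obj = Function.update c.obj o (T.apply (c.obj o) op).1 ∧
      (A.exec inp c (.step p)).reg = c.reg := by
  simp only [exec, hnext, and_self]

open Classical in
theorem exec_step_of_onReg {r : A.Reg} {op : (register A.RegVal).Op}
    {next : (register A.RegVal).Resp → A.Loc} (hnext : A.next p (c.loc p) = .onReg r op next) :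
    (A.exec inp c (.step p)).loc =
        Function.update c.loc p (next ((register A.RegVal).apply (c.reg r) op).2) ∧
      (A.exec inp c (.step p)).obj = c.obj ∧
      (A.exec inp c (.step p)).reg =
        Function.update c.reg r ((register A.RegVal).apply (c.reg r) op).1 := by
  simp only [exec, hnext, and_self]

end Steps

section WaitFreedom

variable {T : ObjType.{u}} {n : ℕ} {D : Type u} {A : Algorithm T n D}

theorem exec_loc_of_ne {inp : Fin n → D} {c : A.Config} {e : Event n} {p : Fin n}
    (hstep : e ≠ .step p) (hcrash : e ≠ .crash p) : (A.exec inp c e).loc p = c.loc p := by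
  rcases e with q | q
  · have hpq : p ≠ q := fun h => hstep (congrArg Event.step h.symm)
    simp only [exec]
    split <;> simp only [Function.update_of_ne hpq]
  · exact Function.update_of_ne (fun h => hcrash (congrArg Event.crash h.symm)) _ _

theorem waitFree_of_rank (rank : A.Loc → ℕ) (inp : Fin n → D)
    (hrank : ∀ c p, (∃ v, A.OutputsIn c p v) ∨
      rank ((A.exec inp c (.step p)).loc p) < rank (c.loc p)) (σ : Schedule n) :
    A.WaitFree inp σ := by
  intro p t₀ hcrash hstep
  by_contra! hout
  have hlt : ∀ t ≥ t₀, σ t = .step p →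
      rank ((A.configAt inp σ (t + 1)).loc p) < rank ((A.configAt inp σ t).loc p) := by
    intro t ht hσ
    rw [configAt, hσ]
    exact (hrank _ p).resolve_left fun ⟨v, hv⟩ => hout t v ht hv
  have hle : ∀ t ≥ t₀,
      rank ((A.configAt inp σ (t + 1)).loc p) ≤ rank ((A.configAt inp σ t).loc p) := by
    intro t ht
    by_cases hσ : σ t = .step p
    · exact (hlt t ht hσ).le
    · rw [configAt, exec_loc_of_ne hσ (hcrash t ht)]
  obtain ⟨t, ht, hmin⟩ := (measure fun t => rank ((A.configAt inp σ t).loc p)).wf.has_min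
    (Set.Ici t₀) Set.nonempty_Ici
  obtain ⟨s, hts, hσ⟩ := hstep t
  refine hmin (s + 1) (ht.trans (hts.trans s.le_succ)) ((hlt s (ht.trans hts) hσ).trans_le ?_)
  exact Nat.le_induction le_rfl (fun i hi => (hle i (ht.trans hi)).trans) s hts

end WaitFreedom

section OneProcess

/-- The algorithm in which each process outputs its own input at once. -/
def outputInput (T : ObjType.{u}) (n : ℕ) (D : Type u) : Algorithm T n D where
  Obj := PEmpty
  objInit := PEmpty.elim
  Reg := PEmpty
  RegVal := PUnit
  regInit := PEmpty.elim
  Loc := D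
  init _ x := x
  next _ x := .output x

theorem outputInput_solvesRC (T : ObjType.{u}) (n : ℕ) (D : Type u) [Subsingleton (Fin n)] :
    (outputInput T n D).SolvesRC := by
  intro inp σ
  have hloc (t : ℕ) (p : Fin n) : ((outputInput T n D).configAt inp σ t).loc p = inp p := by
    induction t with
    | zero => rfl
    | succ t ih =>
      rw [configAt]
      rcases σ t with _ | q
      · exact ih
      · rw [Subsingleton.elim p q]
        exact Function.update_self ..
  have hout {t : ℕ} {p : Fin n} {v : D} : (outputInput T n D).Outputs inp σ t p v ↔ inp p = v := by
    rw [Outputs, hloc]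
    exact Iff.of_eq (Action.output.injEq ..)
  refine ⟨fun t t' p p' v v' hv hv' => ?_, fun t p v hv => ⟨p, hout.1 hv⟩,
    fun p t₀ _ _ => ⟨t₀, inp p, le_rfl, hout.2 rfl⟩⟩
  rw [← hout.1 hv, ← hout.1 hv', Subsingleton.elim p p']

end OneProcess

section TwoProcesses

/-- The local states of `firstWins`. -/
inductive FirstWinsLoc (D : Type u) : Type u
  | start (x : D)
  | announced (x : D)
  | lost
  | decided (x : D)

/-- The local state of `firstWins` after the register of the other process has been read. -/
def FirstWinsLoc.ofRead {D : Type u} : RegResp D → FirstWinsLoc D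
  | .ack => .lost
  | .value y => .decided y

open Classical in
/-- Each process writes its input to its register and applies `a` to a single object, which is
initially in state `s`.  If the response is that of the first application of `a`, the process
outputs its own input, and otherwise the value in the register of the other process. -/
noncomputable def firstWins (T : ObjType.{u}) (D : Type u) [Nonempty D] (s : T.State) (a : T.Op) :
    Algorithm T 2 D where
  Obj := PUnit
  objInit _ := s
  Reg := ULift (Fin 2)
  RegVal := D
  regInit _ := Classical.arbitrary D
  Loc := FirstWinsLoc D
  init _ x := .start x
  next p
    | .start x => .onReg ⟨p⟩ (.write x) fun _ => .announced x
    | .announced x => .onObj ⟨⟩ a fun resp =>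
        if resp = (T.apply s a).2 then .decided x else .lost
    | .lost => .onReg ⟨p.rev⟩ .read .ofRead
    | .decided x => .output x

namespace firstWins

variable {T : ObjType.{u}} {D : Type u} [Nonempty D] {s : T.State} {a : T.Op} {inp : Fin 2 → D}
  {c : (firstWins T D s a).Config} {w : Fin 2}

/-- Invariant of `firstWins` before the first application of `a`. -/
structure Undecided (inp : Fin 2 → D) (c : (firstWins T D s a).Config) : Prop where
  obj : c.obj ⟨⟩ = s
  loc : ∀ p, c.loc p = .start (inp p) ∨ c.loc p = .announced (inp p) ∧ c.reg ⟨p⟩ = inp p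

/-- Invariant of `firstWins` once process `w` has been the first to apply `a`. -/
structure WonBy (w : Fin 2) (inp : Fin 2 → D) (c : (firstWins T D s a).Config) : Prop where
  reg : c.reg ⟨w⟩ = inp w
  winner : c.loc w = .decided (inp w)
  loser : c.loc w.rev = .lost ∨ c.loc w.rev = .decided (inp w) ∨
    c.obj ⟨⟩ = (T.apply s a).1 ∧
      (c.loc w.rev = .start (inp w.rev) ∨ c.loc w.rev = .announced (inp w.rev))

theorem eq_or_eq_rev (p q : Fin 2) : p = q ∨ p = q.rev := by decide +revert

theorem rev_ne (p : Fin 2) : p.rev ≠ p := by decide +revert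

open Classical in
theorem exec_start {p : Fin 2} {x : D} (hp : c.loc p = .start x) :
    ((firstWins T D s a).exec inp c (.step p)).obj = c.obj ∧
      ((firstWins T D s a).exec inp c (.step p)).reg ⟨p⟩ = x ∧
      ((firstWins T D s a).exec inp c (.step p)).reg ⟨p.rev⟩ = c.reg ⟨p.rev⟩ ∧
      ((firstWins T D s a).exec inp c (.step p)).loc p = .announced x := by
  have hnext : (firstWins T D s a).next p (c.loc p) =
    .onReg ⟨p⟩ (.write x) fun _ => FirstWinsLoc.announced x := by rw [hp]; rfl
  obtain ⟨hloc, hobj, hreg⟩ := exec_step_of_onReg (inp := inp) hnext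
  rw [hloc, hobj, hreg]
  have hne : (⟨p.rev⟩ : (firstWins T D s a).Reg) ≠ ⟨p⟩ := fun h =>
    rev_ne p (congrArg ULift.down h)
  exact ⟨rfl, Function.update_self ..,
    @Function.update_of_ne (firstWins T D s a).Reg _ _ _ _ hne _ _, Function.update_self ..⟩

open Classical in
theorem exec_announced {p : Fin 2} {x : D} (hp : c.loc p = .announced x) :
    ((firstWins T D s a).exec inp c (.step p)).obj ⟨⟩ = (T.apply (c.obj ⟨⟩) a).1 ∧
      ((firstWins T D s a).exec inp c (.step p)).reg = c.reg ∧
      ((firstWins T D s a).exec inp c (.step p)).loc p =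
        if (T.apply (c.obj ⟨⟩) a).2 = (T.apply s a).2 then FirstWinsLoc.decided x else .lost := by
  have hnext : (firstWins T D s a).next p (c.loc p) = .onObj ⟨⟩ a fun resp =>
    if resp = (T.apply s a).2 then FirstWinsLoc.decided x else .lost := by rw [hp]; rfl
  obtain ⟨hloc, hobj, hreg⟩ := exec_step_of_onObj (inp := inp) hnext
  rw [hloc, hobj, hreg]
  exact ⟨Function.update_self .., rfl, Function.update_self ..⟩

open Classical in
theorem exec_lost {p : Fin 2} (hp : c.loc p = .lost) :
    ((firstWins T D s a).exec inp c (.step p)).reg = c.reg ∧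
      ((firstWins T D s a).exec inp c (.step p)).loc p = .decided (c.reg ⟨p.rev⟩) := by
  have hnext : (firstWins T D s a).next p (c.loc p) =
    .onReg ⟨p.rev⟩ .read .ofRead := by rw [hp]; rfl
  obtain ⟨hloc, -, hreg⟩ := exec_step_of_onReg (inp := inp) hnext
  rw [hloc, hreg]
  exact ⟨Function.update_eq_self _ _, Function.update_self ..⟩

theorem outputsIn_iff {p : Fin 2} {v : D} :
    (firstWins T D s a).OutputsIn c p v ↔ c.loc p = .decided v := by
  rw [OutputsIn]
  rcases c.loc p <;> simp [firstWins]

theorem exec_step_loc_rev (w : Fin 2) :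
    ((firstWins T D s a).exec inp c (.step w.rev)).loc w = c.loc w :=
  exec_loc_of_ne (fun h => rev_ne w (Event.step.inj h)) (fun h => nomatch h)

theorem Undecided.exec (h : Undecided inp c) (p : Fin 2) :
    Undecided inp ((firstWins T D s a).exec inp c (.step p)) ∨
      WonBy p inp ((firstWins T D s a).exec inp c (.step p)) := by
  have hrev : ((firstWins T D s a).exec inp c (.step p)).loc p.rev = c.loc p.rev := by
    simpa only [Fin.rev_rev] using exec_step_loc_rev (inp := inp) (c := c) p.rev
  rcases h.loc p with hp | ⟨hp, hreg⟩
  · obtain ⟨hobj, hreg, hreg', hloc⟩ := exec_start (inp := inp) hp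
    refine .inl ⟨by rw [hobj, h.obj], fun q => ?_⟩
    rcases eq_or_eq_rev q p with rfl | rfl
    · exact .inr ⟨hloc, hreg⟩
    · rw [hrev, hreg']
      exact h.loc p.rev
  · obtain ⟨hobj, hreg', hloc⟩ := exec_announced (inp := inp) hp
    rw [h.obj] at hobj hloc
    refine .inr ⟨by rw [hreg', hreg], hloc.trans (if_pos rfl), .inr (.inr ⟨hobj, ?_⟩)⟩
    rw [hrev]
    exact (h.loc p.rev).imp_right And.left

theorem WonBy.exec (h : WonBy w inp c) (ha : (T.apply s a).2 ≠ (T.apply (T.apply s a).1 a).2)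
    (p : Fin 2) : WonBy w inp ((firstWins T D s a).exec inp c (.step p)) := by
  have decided {p : Fin 2} {x : D} (hp : c.loc p = .decided x) :
      (firstWins T D s a).exec inp c (.step p) = c := (outputsIn_iff.2 hp).exec_step
  rcases eq_or_eq_rev p w with rfl | rfl
  · rwa [decided h.winner]
  have hwinner := (exec_step_loc_rev (inp := inp) w).trans h.winner
  rcases h.loser with hlost | hdecided | ⟨hobj, hstart | hannounced⟩
  · obtain ⟨hreg, hloc⟩ := exec_lost (inp := inp) hlost
    exact ⟨by rw [hreg, h.reg], hwinner, .inr (.inl (by rw [hloc, Fin.rev_rev, h.reg]))⟩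
  · rwa [decided hdecided]
  · obtain ⟨hobj', -, hreg, hloc⟩ := exec_start (inp := inp) hstart
    rw [Fin.rev_rev] at hreg
    exact ⟨hreg.trans h.reg, hwinner, .inr (.inr ⟨by rw [hobj', hobj], .inr hloc⟩)⟩
  · obtain ⟨-, hreg, hloc⟩ := exec_announced (inp := inp) hannounced
    rw [hobj, if_neg ha.symm] at hloc
    exact ⟨by rw [hreg, h.reg], hwinner, .inl hloc⟩

theorem WonBy.eq_of_outputsIn (h : WonBy w inp c) {p : Fin 2} {v : D}
    (hv : (firstWins T D s a).OutputsIn c p v) : inp w = v := by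
  rw [outputsIn_iff] at hv
  rcases eq_or_eq_rev p w with rfl | rfl
  · exact FirstWinsLoc.decided.inj (h.winner.symm.trans hv)
  · rcases h.loser with hp | hp | ⟨-, hp | hp⟩ <;> cases hv.symm.trans hp
    rfl

/-- An upper bound on the number of steps that a process takes before it outputs a value. -/
def stepsLeft : FirstWinsLoc D → ℕ
  | .start _ => 3
  | .announced _ => 2
  | .lost => 1
  | .decided _ => 0

theorem waitFree (inp : Fin 2 → D) (σ : Schedule 2) : (firstWins T D s a).WaitFree inp σ := by
  refine waitFree_of_rank stepsLeft inp (fun c p => ?_) σ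
  rcases hp : c.loc p with x | x | _ | x
  · right
    rw [(exec_start hp).2.2.2]
    exact Nat.lt_succ_self 2
  · right
    rw [(exec_announced hp).2.2]
    split_ifs <;> simp [stepsLeft]
  · right
    rw [(exec_lost hp).2]
    exact Nat.zero_lt_one
  · exact .inl ⟨x, outputsIn_iff.2 hp⟩

theorem solvesConsensus (ha : (T.apply s a).2 ≠ (T.apply (T.apply s a).1 a).2) :
    (firstWins T D s a).SolvesConsensus := by
  intro inp σ hσ
  let C := (firstWins T D s a).configAt inp σ
  have hstep (t : ℕ) : ∃ p, C (t + 1) = (firstWins T D s a).exec inp (C t) (.step p) := by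
    rcases ht : σ t with p | p
    · exact ⟨p, by simp only [C, configAt, ht]⟩
    · exact (hσ t p ht).elim
  have hinv (t : ℕ) : Undecided inp (C t) ∨ ∃ w, WonBy w inp (C t) := by
    induction t with
    | zero => exact .inl ⟨rfl, fun p => .inl rfl⟩
    | succ t ih =>
      obtain ⟨p, hp⟩ := hstep t
      rw [hp]
      exact ih.elim (fun h => (h.exec p).imp_right fun h => ⟨p, h⟩)
        fun ⟨w, h⟩ => .inr ⟨w, h.exec ha p⟩
  have hwon {t t' : ℕ} (htt' : t ≤ t') {w : Fin 2} (h : WonBy w inp (C t)) :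
      WonBy w inp (C t') := by
    induction t', htt' using Nat.le_induction with
    | base => exact h
    | succ t' _ ih =>
      obtain ⟨p, hp⟩ := hstep t'
      exact hp ▸ ih.exec ha p
  have hout {t : ℕ} {p : Fin 2} {v : D} (hv : (firstWins T D s a).OutputsIn (C t) p v) :
      ∃ w, WonBy w inp (C t) := by
    refine (hinv t).resolve_left fun h => ?_
    simpa [outputsIn_iff.1 hv] using h.loc p
  refine ⟨?_, fun t p v hv => ?_, waitFree inp σ⟩
  · intro t t' p p' v v' hv hv'
    wlog htt' : t ≤ t' generalizing t t' p p' v v'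
    · exact (this t' t p' p v' v hv' hv (le_of_not_ge htt')).symm
    obtain ⟨w, h⟩ := hout hv
    exact (h.eq_of_outputsIn hv).symm.trans ((hwon htt' h).eq_of_outputsIn hv')
  · obtain ⟨w, h⟩ := hout hv
    exact ⟨w, h.eq_of_outputsIn hv⟩

end firstWins

end TwoProcesses

end Algorithm

section Solvability

variable {T : ObjType.{u}} {D : Type u} {n : ℕ}

theorem not_consensusSolvable_of_concealsOrder [Nontrivial D] {m : ℕ} (hT : T.ConcealsOrder m)
    (hn : 2 ≤ n) (hmn : m < n) : ¬ ConsensusSolvable T D n := fun ⟨_, hA⟩ =>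
  have := Fin.nontrivial_iff_two_le.2 hn
  Algorithm.not_solvesUnder_of_concealsOrder CrashRule.live_crashFree hT hmn hA.solvesUnder

theorem not_rcSolvable_of_concealsOrder [Nontrivial D] {m : ℕ} (hT : T.ConcealsOrder m)
    (hn : 2 ≤ n) (hmn : m ≤ n) : ¬ RCSolvable T D n := fun ⟨_, hA⟩ =>
  have := Fin.nontrivial_iff_two_le.2 hn
  Algorithm.not_solvesUnder_afterLowerStep hT hmn (hA.solvesUnder _)

theorem rcSolvable_one (T : ObjType.{u}) (D : Type u) : RCSolvable T D 1 :=
  ⟨_, Algorithm.outputInput_solvesRC T 1 D⟩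

theorem consensusSolvable_two [Nonempty D] {s : T.State} {a : T.Op}
    (ha : (T.apply s a).2 ≠ (T.apply (T.apply s a).1 a).2) : ConsensusSolvable T D 2 :=
  ⟨_, Algorithm.firstWins.solvesConsensus ha⟩

theorem stack_consensusSolvable_two (V D : Type u) [Nonempty V] [Nonempty D] :
    ConsensusSolvable (stack V) D 2 :=
  consensusSolvable_two (s := [Classical.arbitrary V]) (a := .pop) nofun

theorem sSup_solvable_eq {P : ℕ → Prop} {k : ℕ} (hk : P k) (hlt : ∀ n, k < n → ¬ P n) :
    sSup {m : ℕ∞ | ∃ n : ℕ, m = n ∧ P n} = k := by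
  refine IsGreatest.csSup_eq ⟨⟨k, rfl, hk⟩, ?_⟩
  rintro _ ⟨n, rfl, hn⟩
  exact Nat.cast_le.2 (not_lt.1 fun h => hlt n h hn)

end Solvability

end SharedMemory

theorem mainTheorem12 {V D : Type u} [Nonempty V] [Nontrivial D] :
    ¬ SharedMemory.RCSolvable (SharedMemory.stack V) D 2 ∧
    SharedMemory.rcons (SharedMemory.stack V) D = 1 ∧
    SharedMemory.cons (SharedMemory.stack V) D = 2 := by
  have hT := SharedMemory.stack_concealsOrder V
  have hrc (n : ℕ) (hn : 2 ≤ n) : ¬ SharedMemory.RCSolvable (SharedMemory.stack V) D n :=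
    SharedMemory.not_rcSolvable_of_concealsOrder hT hn hn
  have hcons (n : ℕ) (hn : 2 < n) : ¬ SharedMemory.ConsensusSolvable (SharedMemory.stack V) D n :=
    SharedMemory.not_consensusSolvable_of_concealsOrder hT hn.le hn
  exact ⟨hrc 2 le_rfl,
    SharedMemory.sSup_solvable_eq (SharedMemory.rcSolvable_one _ D) hrc,
    SharedMemory.sSup_solvable_eq (SharedMemory.stack_consensusSolvable_two V D) hcons⟩
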